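/- **Corollary (Eigenvectors distributions of Gaussian ensembles).** Let $n$ be a natural number and let $\mathbb{F}$ be one of $\mathbb{R}$, $\mathbb{C}$, $\mathbb{H}$, with $\beta = \dim_{\mathbb{R}}\mathbb{F} \in \{1,2,4\}$. Let $\mathsf{Herm}_n(\mathbb{F}) = \{X \in \mathbb{F}^{n\times n} : X = X^{\mathsf{H}}\}$ (real symmetric, complex Hermitian, or quaternionic self-dual matrices), and let $\mathrm{U}(n,\mathbb{F}) = \{Q \in \mathbb{F}^{n \times n} : Q^{\mathsf{H}}Q = I\}$, i.e. $\mathrm{O}(n)$, $\mathrm{U}(n)$, $\mathrm{Sp}(n)$ respectively. The ensembles $\mathrm{GOE}(n)$, $\mathrm{GUE}(n)$, $\mathrm{GSE}(n)$ are the probability distributions on $\mathsf{Herm}_n(\mathbb{F})$ for $\mathbb{F} = \mathbb{R},\mathbb{C},\mathbb{H}$ with density $$2^{-n/2}\,\pi^{-\beta n(n-1+2/\beta)/4}\, e^{-\operatorname{tr}(X^2)/2}$$ with respect to the Lebesgue measure $\prod_i dx_{ii}\prod_{i<j}dx_{ij}$ in the real diagonal entries and the entries in $\mathbb{F}$ above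 the diagonal. Fix distinct real numbers $a_1,\dots,a_n$ and put $\Delta_a = \operatorname{diag}(a_1,\dots,a_n)$. The complete flag manifold is $$\mathrm{Flag}(\mathbb{F}^n) = \{Q\Delta_aQ^{\mathsf{H}} : Q \in \mathrm{U}(n,\mathbb{F})\},$$ on which $\mathrm{U}(n,\mathbb{F})$ acts by $A\cdot Y = AYA^{\mathsf{H}}$; its uniform distribution $\mathrm{unif}(\mathrm{Flag}(\mathbb{F}^n))$ is the unique probability measure on it that is invariant under this action. For $X \in \mathsf{Herm}_n(\mathbb{F})$ with $n$ distinct eigenvalues, let $$\varphi_{1,\dots,n-1}(X) = Q\Delta_aQ^{\mathsf{H}} \in \mathrm{Flag}(\mathbb{F}^n),$$ where $X = Q\Lambda Q^{\mathsf{H}}$ with $Q \in \mathrm{U}(n,\mathbb{F})$, $\Lambda = \operatorname{diag}(\lambda_1,\dots,\lambda_n)$ and $\lambda_1 > \dots > \lambda_n$; such a decomposition exists and the value does not depend on its choice. A random matrix $X$ from any of the three ensembles has distinct eigenvalues almost surely, so $\varphi_{1,\dots,n-1}(X)$ is an almost surely defined random variable, and: 1. If $X \sim \mathrm{GOE}(n)$,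 then $\varphi_{1,\dots,n-1}(X) \sim \mathrm{unif}(\mathrm{Flag}(\mathbb{R}^n))$. 2. If $X \sim \mathrm{GUE}(n)$, then $\varphi_{1,\dots,n-1}(X) \sim \mathrm{unif}(\mathrm{Flag}(\mathbb{C}^n))$. 3. If $X \sim \mathrm{GSE}(n)$, then $\varphi_{1,\dots,n-1}(X) \sim \mathrm{unif}(\mathrm{Flag}(\mathbb{H}^n))$. -/

import Mathlib

open MeasureTheory ProbabilityTheory

/-- The Borel structure on the quaternions; the resulting `volume` is the Lebesgue measure
`da db dc dd` in the coordinates of `a + b i + c j + d k`. -/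
noncomputable instance Quaternion.instMeasurableSpaceReal : MeasurableSpace (Quaternion ℝ) :=
  borel (Quaternion ℝ)

instance Quaternion.instBorelSpaceReal : BorelSpace (Quaternion ℝ) := ⟨rfl⟩

instance Quaternion.instStarModuleReal : StarModule ℝ (Quaternion ℝ) :=
  ⟨fun r x => by simp⟩

/-- The product structure on matrices, i.e. the one generated by the entries. -/
instance Matrix.instMeasurableSpacePi {m n α : Type*} [MeasurableSpace α] :
    MeasurableSpace (Matrix m n α) :=
  inferInstanceAs (MeasurableSpace (m → n → α))

namespace GaussianFlag

/-! In what follows `𝔽` is used for `𝔽 = ℝ, ℂ, ℍ`; `star` on matrices is the conjugate transpose. -/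

section Algebra

variable (𝔽 : Type) [Ring 𝔽] [StarRing 𝔽] [Algebra ℝ 𝔽] (n : ℕ)

/-- `n × n` matrices over `𝔽`. -/
abbrev Mat : Type := Matrix (Fin n) (Fin n) 𝔽

/-- The self-adjoint matrices `X = Xᴴ`: real symmetric, complex Hermitian, or quaternionic
self-dual. -/
abbrev Herm : Type := selfAdjoint (Mat 𝔽 n)

/-- The groups `O(n)`, `U(n)`, `Sp(n)` of matrices `Q` with `Qᴴ Q = Q Qᴴ = I`. -/
abbrev UnitaryGroup : Type := unitary (Mat 𝔽 n)

variable {n}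

/-- The real diagonal matrix `diag(d₁, …, dₙ)` as a matrix over `𝔽`. -/
def realDiag (d : Fin n → ℝ) : Mat 𝔽 n :=
  Matrix.diagonal fun i => algebraMap ℝ 𝔽 (d i)

variable {𝔽}

/-- The set of (real) eigenvalues of a matrix. All eigenvalues of a self-adjoint matrix are real,
also over the quaternions, where an eigenvalue is a `μ` with `X v = v μ` for some `v ≠ 0`. -/
def realEigenvalues (X : Mat 𝔽 n) : Set ℝ :=
  {μ | ∃ v : Fin n → 𝔽, v ≠ 0 ∧ X.mulVec v = fun i => v i * algebraMap ℝ 𝔽 μ}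

/-- All eigenvalues of the self-adjoint `n × n` matrix `X` are distinct, i.e. it has `n` different
eigenvalues. -/
def HasDistinctEigenvalues (X : Herm 𝔽 n) : Prop :=
  (realEigenvalues (X : Mat 𝔽 n)).ncard = n

/-- `X = Q Λ Qᴴ` with `Q` unitary and `Λ = diag(l₁, …, lₙ)`, `l₁ > ⋯ > lₙ`. -/
structure IsEigenvalueDecomposition (X : Herm 𝔽 n) (Q : UnitaryGroup 𝔽 n) (l : Fin n → ℝ) :
    Prop where
  strictAnti : StrictAnti l
  eq : (X : Mat 𝔽 n) = (Q : Mat 𝔽 n) * realDiag 𝔽 l * star (Q : Mat 𝔽 n)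

variable (𝔽)

/-- The complete flag manifold `Flag(𝔽ⁿ)`, as the matrix manifold `{Q Δₐ Qᴴ : Q unitary}` with
`Δₐ = diag(a₁, …, aₙ)`; the constants `a₁, …, aₙ` are to be distinct. -/
def Flag (a : Fin n → ℝ) : Type :=
  {Y : Mat 𝔽 n // ∃ Q : UnitaryGroup 𝔽 n, Y = (Q : Mat 𝔽 n) * realDiag 𝔽 a * star (Q : Mat 𝔽 n)}

variable {𝔽}

/-- The point `Q Δₐ Qᴴ` of the complete flag manifold. -/
def Flag.mk (a : Fin n → ℝ) (Q : UnitaryGroup 𝔽 n) : Flag 𝔽 a :=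
  ⟨(Q : Mat 𝔽 n) * realDiag 𝔽 a * star (Q : Mat 𝔽 n), Q, rfl⟩

/-- The action `A • Y = A Y Aᴴ` of the unitary group on the complete flag manifold. -/
instance Flag.instMulAction (a : Fin n → ℝ) : MulAction (UnitaryGroup 𝔽 n) (Flag 𝔽 a) where
  smul A Y := ⟨(A : Mat 𝔽 n) * Y.1 * star (A : Mat 𝔽 n), by
    obtain ⟨Q, hQ⟩ := Y.2
    exact ⟨A * Q, by simp only [hQ, Submonoid.coe_mul, star_mul, mul_assoc]⟩⟩
  one_smul Y := Subtype.ext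
    (show ((1 : UnitaryGroup 𝔽 n) : Mat 𝔽 n) * Y.1 * star ((1 : UnitaryGroup 𝔽 n) : Mat 𝔽 n) = Y.1
      by simp)
  mul_smul A B Y := Subtype.ext
    (show ((A * B : UnitaryGroup 𝔽 n) : Mat 𝔽 n) * Y.1 * star ((A * B : UnitaryGroup 𝔽 n) : Mat 𝔽 n)
        = (A : Mat 𝔽 n) * ((B : Mat 𝔽 n) * Y.1 * star (B : Mat 𝔽 n)) * star (A : Mat 𝔽 n)
      by simp only [Submonoid.coe_mul, star_mul, mul_assoc])

open Classical in
/-- The eigenbasis map `φ_{1,…,n-1} : X ↦ Q Δₐ Qᴴ`, where `X = Q Λ Qᴴ` is an eigenvalue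
decomposition with `λ₁ > ⋯ > λₙ`. Where there is no such decomposition (the eigenvalues are not
distinct) the map is given the irrelevant value `Δₐ`. -/
noncomputable def eigenbasisMap (a : Fin n → ℝ) (X : Herm 𝔽 n) : Flag 𝔽 a :=
  if h : ∃ Q : UnitaryGroup 𝔽 n, ∃ l : Fin n → ℝ, IsEigenvalueDecomposition X Q l then
    Flag.mk a h.choose
  else Flag.mk a 1

variable (𝔽 n)

/-- The entries of a self-adjoint matrix: the real diagonal ones, and those above the diagonal. -/
abbrev HermCoord : Type := (Fin n → ℝ) × ({p : Fin n × Fin n // p.1 < p.2} → 𝔽)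

variable {𝔽 n}

/-- The self-adjoint matrix with prescribed diagonal and upper triangular entries. -/
def hermOfCoord [StarModule ℝ 𝔽] (c : HermCoord 𝔽 n) : Herm 𝔽 n :=
  ⟨Matrix.of fun i j =>
      if h : i < j then c.2 ⟨(i, j), h⟩
      else if h : j < i then star (c.2 ⟨(j, i), h⟩)
      else algebraMap ℝ 𝔽 (c.1 i), by
    rw [selfAdjoint.mem_iff, Matrix.star_eq_conjTranspose]
    ext i j
    rcases lt_trichotomy i j with h | h | h
    · simp [Matrix.conjTranspose_apply, h, h.not_gt]
    · subst h
      simp [Matrix.conjTranspose_apply, ← algebraMap_star_comm]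
    · simp [Matrix.conjTranspose_apply, h, h.not_gt]⟩

end Algebra

section Measure

instance Flag.instMeasurableSpace {𝔽 : Type} [Ring 𝔽] [StarRing 𝔽] [Algebra ℝ 𝔽]
    [MeasurableSpace 𝔽] {n : ℕ} (a : Fin n → ℝ) : MeasurableSpace (Flag 𝔽 a) :=
  inferInstanceAs (MeasurableSpace {Y : Mat 𝔽 n //
    ∃ Q : UnitaryGroup 𝔽 n, Y = (Q : Mat 𝔽 n) * realDiag 𝔽 a * star (Q : Mat 𝔽 n)})

/-- The Lebesgue measure `∏ᵢ dxᵢᵢ ∏_{i<j} dxᵢⱼ` on the self-adjoint matrices. -/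
noncomputable def hermVolume (𝔽 : Type) [Ring 𝔽] [StarRing 𝔽] [Algebra ℝ 𝔽] [StarModule ℝ 𝔽]
    [MeasureSpace 𝔽] (n : ℕ) : Measure (Herm 𝔽 n) :=
  Measure.map hermOfCoord (volume : Measure (HermCoord 𝔽 n))

/-- The density `2^{-n/2} π^{-β n (n - 1 + 2/β) / 4} exp(-tr(X²)/2)` with `β = dim_ℝ 𝔽`. The trace
of `X²` is real; it is turned into a real number by `inner ℝ 1`, the real part on `ℝ, ℂ, ℍ`. -/
noncomputable def gaussianDensity (𝔽 : Type) [Ring 𝔽] [StarRing 𝔽] [Algebra ℝ 𝔽] [Inner ℝ 𝔽]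
    (n : ℕ) (X : Herm 𝔽 n) : ℝ :=
  let β : ℝ := Module.finrank ℝ 𝔽
  (2 : ℝ) ^ (-(n : ℝ) / 2) * Real.pi ^ (-(β * n * (n - 1 + 2 / β)) / 4) *
    Real.exp (-(inner ℝ (1 : 𝔽) (Matrix.trace ((X : Mat 𝔽 n) * (X : Mat 𝔽 n)))) / 2)

/-- The Gaussian ensemble on the self-adjoint matrices over `𝔽`. -/
noncomputable def gaussianEnsemble (𝔽 : Type) [Ring 𝔽] [StarRing 𝔽] [Algebra ℝ 𝔽] [StarModule ℝ 𝔽]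
    [Inner ℝ 𝔽] [MeasureSpace 𝔽] (n : ℕ) : Measure (Herm 𝔽 n) :=
  (hermVolume 𝔽 n).withDensity fun X => ENNReal.ofReal (gaussianDensity 𝔽 n X)

/-- The Gaussian orthogonal ensemble `GOE(n)`. -/
noncomputable def GOE (n : ℕ) : Measure (Herm ℝ n) := gaussianEnsemble ℝ n

/-- The Gaussian unitary ensemble `GUE(n)`. -/
noncomputable def GUE (n : ℕ) : Measure (Herm ℂ n) := gaussianEnsemble ℂ n

/-- The Gaussian symplectic ensemble `GSE(n)`. -/
noncomputable def GSE (n : ℕ) : Measure (Herm (Quaternion ℝ) n) := gaussianEnsemble (Quaternion ℝ) n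

/-- `ν` is the uniform distribution on the homogeneous space `M` of `G`: the unique
`G`-invariant probability measure on `M`. -/
structure IsUniformDistribution (G : Type*) {M : Type*} [Group G] [MulAction G M]
    [MeasurableSpace M] (ν : Measure M) : Prop where
  isProbabilityMeasure : IsProbabilityMeasure ν
  invariant : ∀ g : G, ν.map (fun x => g • x) = ν
  unique : ∀ ν' : Measure M, IsProbabilityMeasure ν' →
    (∀ g : G, ν'.map (fun x => g • x) = ν') → ν' = ν

end Measure

end GaussianFlag

/-! The law of `X` is invariant under `X ↦ A X Aᴴ`: the density depends only on `Re tr X²`, and `Re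
tr` is cyclic even over `ℍ` (`reTrace_mul_comm`), while a linear automorphism scales Lebesgue
measure by a constant, which equality of total masses forces to be `1`
(`map_conjHerm_gaussianEnsemble`). Where the eigenvalues are distinct, the eigenbasis map commutes
with the two actions (`eigenbasisMap_conjHerm`), so its law is invariant on the flag manifold. The
unitary group is compact and acts transitively there, so every invariant probability measure is the
image of one Haar measure (`flag_invariant_unique`).

It remains to see that the map is almost surely given by a decomposition and is measurable. The
Hankel determinant of the power sums `Re tr Xⁱ⁺ʲ` is analytic in the entries and nonzero at a
diagonal matrix with distinct entries, hence nonzero almost everywhere. Where it is nonzero there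
are `n` distinct eigenvalues, since otherwise a polynomial of degree below `n` would annihilate `X`.
Traces serve here in place of the characteristic polynomial, so that noncommutativity does no harm.
On this set the map is continuous, by compactness of the unitary group
(`continuousOn_eigenbasisMap`).

The two identities of `IsHurwitz` are what lets one argument treat `ℝ`, `ℂ` and `ℍ` together. -/

namespace GaussianFlag

/-- A normed division algebra over `ℝ` with conjugation `star` and real part `inner ℝ 1`,
as for `ℝ`, `ℂ` and `ℍ`. -/
class IsHurwitz (𝔽 : Type) [NormedDivisionRing 𝔽] [StarRing 𝔽] [NormedAlgebra ℝ 𝔽]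
    [Inner ℝ 𝔽] : Prop where
  star_mul_self (x : 𝔽) : star x * x = algebraMap ℝ 𝔽 (‖x‖ ^ 2)
  add_star (x : 𝔽) : x + star x = algebraMap ℝ 𝔽 (2 * inner ℝ (1 : 𝔽) x)

instance : IsHurwitz ℝ where
  star_mul_self x := by simp [sq]
  add_star x := by simp; ring

instance : IsHurwitz ℂ where
  star_mul_self x := by simp [← Complex.normSq_eq_norm_sq, Complex.normSq_eq_conj_mul_self]
  add_star x := by
    have : inner ℝ (1 : ℂ) x = x.re := by simp [Complex.inner]
    rw [this]; simp [Complex.add_conj]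

instance : IsHurwitz (Quaternion ℝ) where
  star_mul_self x := by
    rw [Quaternion.star_mul_self, Quaternion.normSq_eq_norm_mul_self, ← sq]; rfl
  add_star x := by
    have : inner ℝ (1 : Quaternion ℝ) x = x.re := by simp [Quaternion.inner_def]
    rw [this, Quaternion.self_add_star, map_mul, map_ofNat]; rfl


/-! ### The real part as a trace on `𝔽`. -/

section Real

variable {𝔽 : Type} [NormedDivisionRing 𝔽] [StarRing 𝔽] [NormedAlgebra ℝ 𝔽] [Inner ℝ 𝔽]
  [IsHurwitz 𝔽]

variable (𝔽) in
/-- The real part `x ↦ inner ℝ 1 x` as a linear functional. -/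
noncomputable def rePart [StarModule ℝ 𝔽] : 𝔽 →ₗ[ℝ] ℝ where
  toFun x := inner ℝ (1 : 𝔽) x
  map_add' x y := by
    -- `Inner` carries no axioms; linearity is read off from `x + star x = 2 Re x`.
    apply (algebraMap ℝ 𝔽).injective
    have h2 : (algebraMap ℝ 𝔽 2) ≠ 0 := by simp
    apply mul_left_cancel₀ h2
    rw [← map_mul, ← IsHurwitz.add_star, map_add, mul_add, ← map_mul, ← map_mul,
      ← IsHurwitz.add_star, ← IsHurwitz.add_star, star_add]
    abel
  map_smul' r x := by
    apply (algebraMap ℝ 𝔽).injective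
    have h2 : (algebraMap ℝ 𝔽 2) ≠ 0 := by simp
    apply mul_left_cancel₀ h2
    rw [← map_mul, ← IsHurwitz.add_star, ← map_mul, star_smul, star_trivial, ← smul_add,
      IsHurwitz.add_star, ← algebraMap_smul 𝔽 r, smul_eq_mul, ← map_mul]
    simp only [RingHom.id_apply, smul_eq_mul]
    congr 1; ring

variable [StarModule ℝ 𝔽]

lemma rePart_apply (x : 𝔽) : rePart 𝔽 x = inner ℝ (1 : 𝔽) x := rfl

lemma star_eq_sub (x : 𝔽) : star x = algebraMap ℝ 𝔽 (2 * rePart 𝔽 x) - x := by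
  rw [rePart_apply, ← IsHurwitz.add_star]; abel

lemma rePart_algebraMap (r : ℝ) : rePart 𝔽 (algebraMap ℝ 𝔽 r) = r := by
  have h := IsHurwitz.add_star (algebraMap ℝ 𝔽 r)
  rw [← algebraMap_star_comm, star_trivial, ← map_add, ← rePart_apply] at h
  have := (algebraMap ℝ 𝔽).injective h
  linarith

lemma rePart_star (x : 𝔽) : rePart 𝔽 (star x) = rePart 𝔽 x := by
  rw [star_eq_sub, map_sub, rePart_algebraMap]; ring

/-- Substituting `star x = 2 Re x - x` in `star (x * y) = star y * star x` makes `x * y + star (x *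
y)` symmetric in `x` and `y`, as real scalars are central. -/
lemma rePart_mul_comm (x y : 𝔽) : rePart 𝔽 (x * y) = rePart 𝔽 (y * x) := by
  have h : x * y + star (x * y) = y * x + star (y * x) := by
    rw [star_mul, star_mul, star_eq_sub x, star_eq_sub y]
    have e1 := Algebra.commutes (2 * rePart 𝔽 x) y
    have e2 := Algebra.commutes (2 * rePart 𝔽 y) x
    have e3 := Algebra.commutes (2 * rePart 𝔽 x) (algebraMap ℝ 𝔽 (2 * rePart 𝔽 y))
    simp only [sub_mul, mul_sub, e1, e2, e3]
    abel
  rw [IsHurwitz.add_star, IsHurwitz.add_star] at h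
  have := (algebraMap ℝ 𝔽).injective h
  rw [rePart_apply, rePart_apply]; linarith

end Real

/-! ### Unitary diagonalization and well-definedness of the eigenbasis map. -/

section Matrices

variable {𝔽 : Type} [NormedDivisionRing 𝔽] [StarRing 𝔽] [NormedAlgebra ℝ 𝔽] [Inner ℝ 𝔽]
  [IsHurwitz 𝔽] {n : ℕ}

lemma star_dotProduct_self (v : Fin n → 𝔽) :
    star v ⬝ᵥ v = algebraMap ℝ 𝔽 (∑ i, ‖v i‖ ^ 2) := by
  simp [dotProduct, IsHurwitz.star_mul_self]

omit [StarRing 𝔽] [NormedAlgebra ℝ 𝔽] [Inner ℝ 𝔽] [IsHurwitz 𝔽] in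
lemma sum_norm_sq_pos {v : Fin n → 𝔽} (hv : v ≠ 0) : 0 < ∑ i, ‖v i‖ ^ 2 := by
  obtain ⟨i, hi⟩ := Function.ne_iff.1 hv
  exact Finset.sum_pos' (fun i _ => by positivity)
    ⟨i, Finset.mem_univ _, by have := norm_pos_iff.2 hi; positivity⟩

omit [NormedAlgebra ℝ 𝔽] [Inner ℝ 𝔽] [IsHurwitz 𝔽] in
lemma mem_unitary_of_star_mul_self {Q : Mat 𝔽 n} (h : star Q * Q = 1) : Q ∈ unitary (Mat 𝔽 n) :=
  Unitary.mem_iff.2 ⟨h, mul_eq_one_comm.1 h⟩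

lemma exists_unit_eigenvector [StarModule ℝ 𝔽] {X : Mat 𝔽 n} {μ : ℝ}
    (h : μ ∈ realEigenvalues X) :
    ∃ v : Fin n → 𝔽, star v ⬝ᵥ v = 1 ∧ X.mulVec v = fun i => v i * algebraMap ℝ 𝔽 μ := by
  obtain ⟨v, hv, hX⟩ := h
  have hpos := sum_norm_sq_pos hv
  set r := ∑ i, ‖v i‖ ^ 2 with hr
  refine ⟨(Real.sqrt r)⁻¹ • v, ?_, ?_⟩
  · rw [star_smul, star_trivial, smul_dotProduct, dotProduct_smul, star_dotProduct_self, ← hr,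
      smul_smul, Algebra.smul_def, ← map_mul, ← mul_inv, Real.mul_self_sqrt hpos.le,
      inv_mul_cancel₀ hpos.ne', map_one]
  · rw [Matrix.mulVec_smul, hX]
    ext i
    simp

omit [Inner ℝ 𝔽] [IsHurwitz 𝔽] in
-- Evaluating `vᴴ X w` on either side gives both `μ (vᴴ w)` and `ν (vᴴ w)`.
lemma star_dotProduct_eq_zero_of_ne {X : Mat 𝔽 n} (hX : star X = X) {μ ν : ℝ}
    (hne : μ ≠ ν) {v w : Fin n → 𝔽} (hv : X.mulVec v = fun i => v i * algebraMap ℝ 𝔽 μ)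
    (hw : X.mulVec w = fun i => w i * algebraMap ℝ 𝔽 ν) [StarModule ℝ 𝔽] : star v ⬝ᵥ w = 0 := by
  have h1 : star v ⬝ᵥ X.mulVec w = algebraMap ℝ 𝔽 ν * (star v ⬝ᵥ w) := by
    rw [hw]
    simp only [dotProduct, Finset.mul_sum]
    refine Finset.sum_congr rfl fun i _ => ?_
    rw [Algebra.commutes, mul_assoc]
  have h2 : star v ⬝ᵥ X.mulVec w = algebraMap ℝ 𝔽 μ * (star v ⬝ᵥ w) := by
    rw [Matrix.dotProduct_mulVec]
    have : Matrix.vecMul (star v) X = star (X.mulVec v) := by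
      rw [Matrix.star_mulVec, ← Matrix.star_eq_conjTranspose, hX]
    rw [this, hv]
    simp only [dotProduct, Finset.mul_sum]
    refine Finset.sum_congr rfl fun i _ => ?_
    simp [← algebraMap_star_comm, mul_assoc]
  have h3 : algebraMap ℝ 𝔽 (μ - ν) * (star v ⬝ᵥ w) = 0 := by
    rw [map_sub, sub_mul, ← h1, ← h2, sub_self]
  rcases mul_eq_zero.1 h3 with h | h
  · rw [map_eq_zero_iff _ (algebraMap ℝ 𝔽).injective, sub_eq_zero] at h
    exact absurd h hne
  · exact h

variable [StarModule ℝ 𝔽]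

/-- A self-adjoint matrix with eigenvalues `l₁ > ⋯ > lₙ` is unitarily diagonalizable. -/
lemma exists_isEigenvalueDecomposition (X : Herm 𝔽 n) {l : Fin n → ℝ} (hl : StrictAnti l)
    (h : ∀ i, l i ∈ realEigenvalues (X : Mat 𝔽 n)) :
    ∃ Q, IsEigenvalueDecomposition X Q l := by
  choose v hv1 hv2 using fun i => exists_unit_eigenvector (h i)
  let Q : Mat 𝔽 n := Matrix.of fun i j => v j i
  have hX : star (X : Mat 𝔽 n) = X := X.2
  have hQ : star Q * Q = 1 := by
    ext i j
    have e : (star Q * Q) i j = star (v i) ⬝ᵥ v j := by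
      simp [Matrix.mul_apply, dotProduct, Q, Matrix.star_apply]
    rw [e]
    by_cases hij : i = j
    · subst hij; rw [hv1, Matrix.one_apply_eq]
    · rw [Matrix.one_apply_ne hij]
      exact star_dotProduct_eq_zero_of_ne hX (hl.injective.ne hij) (hv2 i) (hv2 j)
  have hQ' := mem_unitary_of_star_mul_self hQ
  refine ⟨⟨Q, hQ'⟩, hl, ?_⟩
  have hXQ : (X : Mat 𝔽 n) * Q = Q * realDiag 𝔽 l := by
    ext i j
    rw [realDiag, Matrix.mul_diagonal]
    exact congrFun (hv2 j) i
  show (X : Mat 𝔽 n) = Q * realDiag 𝔽 l * star Q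
  rw [← hXQ, mul_assoc, (Unitary.mem_iff.1 hQ').2, mul_one]

omit [IsHurwitz 𝔽] [Inner ℝ 𝔽] [StarModule ℝ 𝔽] in
/-- The eigenvalues of `Q Λ Qᴴ` are the diagonal entries of `Λ`. -/
lemma realEigenvalues_conj_realDiag (Q : UnitaryGroup 𝔽 n) (l : Fin n → ℝ) :
    realEigenvalues ((Q : Mat 𝔽 n) * realDiag 𝔽 l * star (Q : Mat 𝔽 n)) = Set.range l := by
  have h1 : star (Q : Mat 𝔽 n) * Q = 1 := Unitary.coe_star_mul_self Q
  have h2 : (Q : Mat 𝔽 n) * star (Q : Mat 𝔽 n) = 1 := Unitary.coe_mul_star_self Q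
  -- Matrices act from the left and eigenvalues from the right, so the two commute.
  have key : ∀ (A : Mat 𝔽 n) (w : Fin n → 𝔽) (μ : ℝ),
      A.mulVec (fun i => w i * algebraMap ℝ 𝔽 μ)
        = fun i => A.mulVec w i * algebraMap ℝ 𝔽 μ := by
    intro A w μ
    ext i
    simp [Matrix.mulVec, dotProduct, Finset.sum_mul, mul_assoc]
  ext μ
  constructor
  · rintro ⟨v, hv, h⟩
    set w := (star (Q : Mat 𝔽 n)).mulVec v with hw
    have hvw : v = (Q : Mat 𝔽 n).mulVec w := by
      rw [hw, Matrix.mulVec_mulVec, h2, Matrix.one_mulVec]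
    have hw0 : w ≠ 0 := by
      intro h0; apply hv; rw [hvw, h0, Matrix.mulVec_zero]
    have h' : (realDiag 𝔽 l).mulVec w = fun i => w i * algebraMap ℝ 𝔽 μ := by
      rw [hw, ← key, ← h, Matrix.mulVec_mulVec, Matrix.mulVec_mulVec, ← mul_assoc, ← mul_assoc,
        h1, one_mul]
    obtain ⟨i, hi⟩ := Function.ne_iff.1 hw0
    refine ⟨i, ?_⟩
    have := congrFun h' i
    rw [realDiag, Matrix.mulVec_diagonal, Algebra.commutes] at this
    exact (algebraMap ℝ 𝔽).injective (mul_left_cancel₀ hi this)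
  · rintro ⟨i, rfl⟩
    refine ⟨(Q : Mat 𝔽 n).mulVec (Pi.single i 1), ?_, ?_⟩
    · intro h0
      have := congrArg (star (Q : Mat 𝔽 n)).mulVec h0
      rw [Matrix.mulVec_mulVec, h1, Matrix.one_mulVec, Matrix.mulVec_zero] at this
      simpa using congrFun this i
    · rw [Matrix.mulVec_mulVec, mul_assoc, h1, mul_one, ← key, ← Matrix.mulVec_mulVec]
      congr 1
      ext j
      rw [realDiag, Matrix.mulVec_diagonal, Algebra.commutes]
      by_cases hij : j = i
      · subst hij; rfl
      · simp [hij]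

omit [IsHurwitz 𝔽] [Inner ℝ 𝔽] [StarModule ℝ 𝔽] in
lemma IsEigenvalueDecomposition.range_eq {X : Herm 𝔽 n} {Q : UnitaryGroup 𝔽 n} {l : Fin n → ℝ}
    (h : IsEigenvalueDecomposition X Q l) : Set.range l = realEigenvalues (X : Mat 𝔽 n) := by
  rw [h.eq, realEigenvalues_conj_realDiag]

omit [IsHurwitz 𝔽] [Inner ℝ 𝔽] [StarModule ℝ 𝔽] in
lemma IsEigenvalueDecomposition.hasDistinctEigenvalues {X : Herm 𝔽 n} {Q : UnitaryGroup 𝔽 n}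
    {l : Fin n → ℝ} (h : IsEigenvalueDecomposition X Q l) : HasDistinctEigenvalues X := by
  rw [HasDistinctEigenvalues, ← h.range_eq, ← Set.image_univ,
    Set.ncard_image_of_injective _ h.strictAnti.injective, Set.ncard_univ, Nat.card_fin]

/-- Every finite set of reals with at least `n` elements contains a decreasing `n`-sequence. -/
lemma exists_strictAnti_of_le_card (s : Finset ℝ) {n : ℕ} (hs : n ≤ s.card) :
    ∃ l : Fin n → ℝ, StrictAnti l ∧ ∀ i, l i ∈ s := by
  obtain ⟨t, hts, htc⟩ := Finset.exists_subset_card_eq hs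
  refine ⟨fun i => t.orderEmbOfFin htc i.rev, ?_, fun i => hts (t.orderEmbOfFin_mem htc _)⟩
  intro i j hij
  exact (t.orderEmbOfFin htc).strictMono (Fin.rev_lt_rev.2 hij)

lemma HasDistinctEigenvalues.exists_isEigenvalueDecomposition {X : Herm 𝔽 n}
    (h : HasDistinctEigenvalues X) : ∃ Q l, IsEigenvalueDecomposition X Q l := by
  have : ∃ s : Finset ℝ, n ≤ s.card ∧ (s : Set ℝ) ⊆ realEigenvalues (X : Mat 𝔽 n) := by
    -- `ncard` is `0` on infinite sets, so finiteness follows only for `n > 0`.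
    rcases Nat.eq_zero_or_pos n with h0 | h0
    · exact ⟨∅, by simp [h0], by simp⟩
    · have hf : (realEigenvalues (X : Mat 𝔽 n)).Finite :=
        Set.finite_of_ncard_pos (by rw [h]; exact h0)
      refine ⟨hf.toFinset, ?_, by simp⟩
      rw [← Set.ncard_eq_toFinset_card _ hf, h]
  obtain ⟨s, hs, hsub⟩ := this
  obtain ⟨l, hl, hls⟩ := exists_strictAnti_of_le_card s hs
  obtain ⟨Q, hQ⟩ := GaussianFlag.exists_isEigenvalueDecomposition X hl fun i => hsub (hls i)
  exact ⟨Q, l, hQ⟩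

omit [IsHurwitz 𝔽] [Inner ℝ 𝔽] [StarModule ℝ 𝔽] in
-- The spectrum determines its decreasing enumeration, so both decompositions share `Λ`. Then `D =
-- Qᴴ R` commutes with `Λ`, whose entries are distinct; hence `D` is diagonal and commutes with `Δₐ`
-- too.
lemma IsEigenvalueDecomposition.mk_eq {X : Herm 𝔽 n} {Q R : UnitaryGroup 𝔽 n} {l m : Fin n → ℝ}
    (h : IsEigenvalueDecomposition X Q l) (h' : IsEigenvalueDecomposition X R m)
    (a : Fin n → ℝ) : Flag.mk a Q = Flag.mk a R := by
  have hlm : l = m := (StrictAnti.range_inj h.strictAnti h'.strictAnti).1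
    (h.range_eq.trans h'.range_eq.symm)
  subst hlm
  have hQ1 : star (Q : Mat 𝔽 n) * Q = 1 := Unitary.coe_star_mul_self Q
  have hQ2 : (Q : Mat 𝔽 n) * star (Q : Mat 𝔽 n) = 1 := Unitary.coe_mul_star_self Q
  have hR1 : star (R : Mat 𝔽 n) * R = 1 := Unitary.coe_star_mul_self R
  have hR2 : (R : Mat 𝔽 n) * star (R : Mat 𝔽 n) = 1 := Unitary.coe_mul_star_self R
  set D : Mat 𝔽 n := star (Q : Mat 𝔽 n) * R with hD
  have hcomm : D * realDiag 𝔽 l = realDiag 𝔽 l * D := by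
    have e : (Q : Mat 𝔽 n) * realDiag 𝔽 l * star (Q : Mat 𝔽 n)
      = (R : Mat 𝔽 n) * realDiag 𝔽 l * star (R : Mat 𝔽 n) := h.eq.symm.trans h'.eq
    calc D * realDiag 𝔽 l
        = star (Q : Mat 𝔽 n) * ((R : Mat 𝔽 n) * realDiag 𝔽 l * star (R : Mat 𝔽 n)) * R := by
          rw [hD]; simp only [mul_assoc, hR1, mul_one]
      _ = (star (Q : Mat 𝔽 n) * Q) * realDiag 𝔽 l * D := by
          rw [← e, hD]; simp only [mul_assoc]
      _ = realDiag 𝔽 l * D := by rw [hQ1, one_mul]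
  have hzero : ∀ i j, i ≠ j → D i j = 0 := by
    intro i j hij
    have := congrFun (congrFun hcomm i) j
    rw [realDiag, Matrix.mul_diagonal, Matrix.diagonal_mul, ← Algebra.commutes, ← sub_eq_zero,
      ← sub_mul, ← map_sub] at this
    rcases mul_eq_zero.1 this with h0 | h0
    · rw [map_eq_zero_iff _ (algebraMap ℝ 𝔽).injective, sub_eq_zero] at h0
      exact absurd (h.strictAnti.injective h0).symm hij
    · exact h0
  have hcomm' : D * realDiag 𝔽 a = realDiag 𝔽 a * D := by
    ext i j
    rw [realDiag, Matrix.mul_diagonal, Matrix.diagonal_mul]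
    by_cases hij : i = j
    · subst hij; rw [Algebra.commutes]
    · simp [hzero i j hij]
  have hRQ : (R : Mat 𝔽 n) = Q * D := by rw [hD, ← mul_assoc, hQ2, one_mul]
  apply Subtype.ext
  show (Q : Mat 𝔽 n) * realDiag 𝔽 a * star (Q : Mat 𝔽 n)
    = (R : Mat 𝔽 n) * realDiag 𝔽 a * star (R : Mat 𝔽 n)
  have hR : (R : Mat 𝔽 n) * realDiag 𝔽 a * star (R : Mat 𝔽 n)
      = Q * (realDiag 𝔽 a * D) * star (R : Mat 𝔽 n) := by
    rw [← hcomm', ← mul_assoc, ← hRQ]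
  rw [hR, hD]
  simp only [mul_assoc, hR2, mul_one]

omit [IsHurwitz 𝔽] [Inner ℝ 𝔽] [StarModule ℝ 𝔽] in
lemma IsEigenvalueDecomposition.eigenbasisMap_eq {X : Herm 𝔽 n} {Q : UnitaryGroup 𝔽 n}
    {l : Fin n → ℝ} (h : IsEigenvalueDecomposition X Q l) (a : Fin n → ℝ) :
    eigenbasisMap a X = Flag.mk a Q := by
  have hex : ∃ Q : UnitaryGroup 𝔽 n, ∃ l : Fin n → ℝ, IsEigenvalueDecomposition X Q l :=
    ⟨Q, l, h⟩
  rw [eigenbasisMap, dif_pos hex]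
  exact hex.choose_spec.choose_spec.mk_eq h a

end Matrices
-- The spectral theorem over `ℝ` and the Hankel determinant test for distinct eigenvalues.
section Spectral

/-- The spectral theorem for a symmetric operator with respect to an inner product that is not
registered as an instance. -/
lemma iSup_eigenspace_eq_top_of_core {V : Type*} [AddCommGroup V] [Module ℝ V]
    [FiniteDimensional ℝ V] (c : InnerProductSpace.Core ℝ V) (T : V →ₗ[ℝ] V)
    (hT : ∀ x y, c.inner (T x) y = c.inner x (T y)) :
    ⨆ μ, Module.End.eigenspace T μ = ⊤ := by
  let _ : NormedAddCommGroup V := c.toNormedAddCommGroup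
  let _ : InnerProductSpace ℝ V := InnerProductSpace.ofCore c.toCore
  have hs : T.IsSymmetric := hT
  exact Submodule.orthogonal_eq_bot_iff.1 hs.orthogonalComplement_iSup_eigenspaces_eq_bot

/-- A diagonalizable operator is annihilated by `∏ (X - μ)` over its eigenvalues `μ`. -/
lemma aeval_prod_eq_zero {V : Type*} [AddCommGroup V] [Module ℝ V] (T : Module.End ℝ V)
    (hT : ⨆ μ, T.eigenspace μ = ⊤) (s : Finset ℝ) (hs : ∀ μ, T.HasEigenvalue μ → μ ∈ s) :
    Polynomial.aeval T (∏ μ ∈ s, (Polynomial.X - Polynomial.C μ)) = 0 := by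
  rw [← LinearMap.ker_eq_top, eq_top_iff, ← hT]
  refine iSup_le fun μ v hv => ?_
  rw [LinearMap.mem_ker]
  by_cases h0 : v = 0
  · simp [h0]
  · have hev : T.HasEigenvector μ v := ⟨hv, h0⟩
    have hmem := hs μ (Module.End.hasEigenvalue_of_hasEigenvector hev)
    rw [Module.End.aeval_apply_of_hasEigenvector hev, Polynomial.eval_prod,
      Finset.prod_eq_zero hmem (by simp), zero_smul]

variable {𝔽 : Type} [NormedDivisionRing 𝔽] [NormedAlgebra ℝ 𝔽] {n : ℕ}

/-- Matrices act on column vectors by `ℝ`-linear maps. -/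
noncomputable def mulVecAlgHom (𝔽 : Type) [NormedDivisionRing 𝔽] [NormedAlgebra ℝ 𝔽] (n : ℕ) :
    Mat 𝔽 n →ₐ[ℝ] Module.End ℝ (Fin n → 𝔽) :=
  AlgHom.ofLinearMap
    { toFun := fun A =>
        { toFun := A.mulVec
          map_add' := A.mulVec_add
          map_smul' := fun r v => A.mulVec_smul r v }
      map_add' := fun A B => LinearMap.ext fun v => A.add_mulVec B v
      map_smul' := fun r A => LinearMap.ext fun v => Matrix.smul_mulVec r A v }
    (LinearMap.ext fun v => Matrix.one_mulVec v)
    (fun A B => LinearMap.ext fun v => (Matrix.mulVec_mulVec v A B).symm)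

lemma mulVecAlgHom_apply (A : Mat 𝔽 n) (v : Fin n → 𝔽) : mulVecAlgHom 𝔽 n A v = A.mulVec v := rfl

lemma mulVecAlgHom_injective : Function.Injective (mulVecAlgHom 𝔽 n) := fun _ _ h =>
  Matrix.ext_of_mulVec_single fun _ => LinearMap.congr_fun h _

lemma hasEigenvalue_mulVecAlgHom_iff {A : Mat 𝔽 n} {μ : ℝ} :
    (mulVecAlgHom 𝔽 n A).HasEigenvalue μ ↔ μ ∈ realEigenvalues A := by
  constructor
  · intro h
    obtain ⟨v, hv⟩ := h.exists_hasEigenvector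
    refine ⟨v, hv.2, ?_⟩
    rw [← mulVecAlgHom_apply, hv.apply_eq_smul]
    ext i
    rw [Pi.smul_apply, Algebra.smul_def, Algebra.commutes]
  · rintro ⟨v, hv, h⟩
    refine Module.End.hasEigenvalue_of_hasEigenvector (x := v) ⟨?_, hv⟩
    rw [Module.End.mem_eigenspace_iff, mulVecAlgHom_apply, h]
    ext i
    rw [Pi.smul_apply, Algebra.smul_def, Algebra.commutes]

variable [StarRing 𝔽] [StarModule ℝ 𝔽] [Inner ℝ 𝔽] [IsHurwitz 𝔽]

variable (𝔽 n) in
/-- The inner product `Re (vᴴ w)` on `𝔽ⁿ`. -/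
noncomputable abbrev columnCore : InnerProductSpace.Core ℝ (Fin n → 𝔽) where
  inner v w := rePart 𝔽 (star v ⬝ᵥ w)
  conj_inner_symm v w := by
    show rePart 𝔽 (star w ⬝ᵥ v) = _
    rw [← rePart_star, ← Matrix.star_dotProduct]
  re_inner_nonneg v := by
    show 0 ≤ rePart 𝔽 (star v ⬝ᵥ v)
    rw [star_dotProduct_self, rePart_algebraMap]
    positivity
  add_left u v w := by simp only [star_add, add_dotProduct, map_add]
  smul_left v w r := by simp [star_smul, smul_dotProduct]
  definite v h := by
    by_contra hv
    have := sum_norm_sq_pos hv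
    rw [star_dotProduct_self, rePart_algebraMap] at h
    exact this.ne' h

omit [StarRing 𝔽] [StarModule ℝ 𝔽] [Inner ℝ 𝔽] [IsHurwitz 𝔽] in
lemma finite_realEigenvalues [FiniteDimensional ℝ 𝔽] (A : Mat 𝔽 n) : (realEigenvalues A).Finite := by
  have := Module.End.finite_hasEigenvalue (mulVecAlgHom 𝔽 n A)
  refine this.subset fun μ hμ => hasEigenvalue_mulVecAlgHom_iff.2 hμ

/-- A self-adjoint matrix is annihilated by `∏ (X - μ)` over its eigenvalues `μ`. -/
lemma aeval_prod_realEigenvalues [FiniteDimensional ℝ 𝔽] (X : Herm 𝔽 n) :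
    Polynomial.aeval (X : Mat 𝔽 n)
      (∏ μ ∈ (finite_realEigenvalues (X : Mat 𝔽 n)).toFinset,
        (Polynomial.X - Polynomial.C μ)) = 0 := by
  -- As a real operator on columns, `X` is symmetric for `Re (vᴴ w)`, so the real spectral theorem
  -- applies over `ℍ` as well.
  apply mulVecAlgHom_injective
  rw [← Polynomial.aeval_algHom_apply, map_zero]
  apply aeval_prod_eq_zero
  · refine iSup_eigenspace_eq_top_of_core (columnCore 𝔽 n) _ fun v w => ?_
    show rePart 𝔽 (star (Matrix.mulVec (X : Mat 𝔽 n) v) ⬝ᵥ w)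
      = rePart 𝔽 (star v ⬝ᵥ Matrix.mulVec (X : Mat 𝔽 n) w)
    have hX : star (X : Mat 𝔽 n) = X := X.2
    rw [Matrix.star_mulVec, ← Matrix.star_eq_conjTranspose, hX, Matrix.dotProduct_mulVec]
  · intro μ hμ
    simpa using hasEigenvalue_mulVecAlgHom_iff.1 hμ

variable (𝔽 n) in
/-- The real part of the trace. -/
noncomputable def reTrace : Mat 𝔽 n →ₗ[ℝ] ℝ := rePart 𝔽 ∘ₗ Matrix.traceLinearMap (Fin n) ℝ 𝔽

lemma reTrace_apply (A : Mat 𝔽 n) : reTrace 𝔽 n A = rePart 𝔽 A.trace := rfl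

lemma reTrace_mul_comm (A B : Mat 𝔽 n) : reTrace 𝔽 n (A * B) = reTrace 𝔽 n (B * A) := by
  simp only [reTrace_apply, Matrix.trace, Matrix.diag, Matrix.mul_apply, map_sum]
  rw [Finset.sum_comm]
  exact Finset.sum_congr rfl fun i _ => Finset.sum_congr rfl fun j _ => rePart_mul_comm _ _

/-- The Hankel matrix of the power sums `Re tr Xᵏ`. -/
noncomputable def powerSumMatrix (A : Mat 𝔽 n) : Matrix (Fin n) (Fin n) ℝ :=
  Matrix.of fun i j => reTrace 𝔽 n (A ^ (i + j : ℕ))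

/-- The Hankel matrix is singular if `A` is a root of a polynomial of degree less than `n`. -/
lemma det_powerSumMatrix_eq_zero {A : Mat 𝔽 n} {p : Polynomial ℝ} (hp : p.Monic)
    (hdeg : p.natDegree < n) (h : Polynomial.aeval A p = 0) : (powerSumMatrix A).det = 0 := by
  rw [← Matrix.exists_mulVec_eq_zero_iff]
  -- The coefficient vector of `p` lies in the kernel: entry `i` of the product is `Re tr (Aⁱ
  -- p(A))`. It is nonzero because `p` is monic of degree below `n`.
  refine ⟨fun j => p.coeff j, ?_, ?_⟩
  · intro h0
    have := congrFun h0 ⟨p.natDegree, hdeg⟩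
    simp [hp.leadingCoeff] at this
  · ext i
    have hsum : ∑ j : Fin n, p.coeff j • A ^ (j : ℕ) = 0 := by
      rw [← h, Polynomial.aeval_eq_sum_range' hdeg, Fin.sum_univ_eq_sum_range
        (fun j => p.coeff j • A ^ j)]
    have : ∑ j : Fin n, p.coeff j • reTrace 𝔽 n (A ^ (i + j : ℕ)) = 0 := by
      have h2 := congrArg (fun B => reTrace 𝔽 n (A ^ (i : ℕ) * B)) hsum
      simpa [Finset.mul_sum, pow_add] using h2
    simpa [Matrix.mulVec, dotProduct, powerSumMatrix, mul_comm] using this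

/-- With fewer than `n` eigenvalues, `∏ (X - μ)` would be an annihilating polynomial of degree below
`n`, making the Hankel matrix singular. -/
lemma exists_isEigenvalueDecomposition_of_det_ne_zero [FiniteDimensional ℝ 𝔽] {X : Herm 𝔽 n}
    (h : (powerSumMatrix (X : Mat 𝔽 n)).det ≠ 0) : ∃ Q l, IsEigenvalueDecomposition X Q l := by
  set s := (finite_realEigenvalues (X : Mat 𝔽 n)).toFinset with hs
  have hcard : n ≤ s.card := by
    by_contra hlt
    refine h (det_powerSumMatrix_eq_zero (Polynomial.monic_prod_X_sub_C id s) ?_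
      (aeval_prod_realEigenvalues X))
    rw [Polynomial.natDegree_finsetProd_X_sub_C_eq_card]
    omega
  obtain ⟨l, hl, hls⟩ := exists_strictAnti_of_le_card s hcard
  obtain ⟨Q, hQ⟩ := exists_isEigenvalueDecomposition X hl fun i => by simpa [hs] using hls i
  exact ⟨Q, l, hQ⟩

lemma det_powerSumMatrix_realDiag_ne_zero {l : Fin n → ℝ} (hl : Function.Injective l) :
    (powerSumMatrix (realDiag 𝔽 l)).det ≠ 0 := by
  have : powerSumMatrix (realDiag 𝔽 l) =
      (Matrix.vandermonde l).transpose * Matrix.vandermonde l := by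
    ext i j
    simp only [powerSumMatrix, Matrix.of_apply, realDiag, Matrix.diagonal_pow, reTrace_apply,
      Matrix.trace_diagonal, Matrix.mul_apply, Matrix.transpose_apply, Matrix.vandermonde_apply,
      ← pow_add, map_sum, Pi.pow_apply, ← map_pow, rePart_algebraMap]
  rw [this, Matrix.det_mul, Matrix.det_transpose]
  exact mul_self_ne_zero.2 (Matrix.det_vandermonde_ne_zero_iff.2 hl)

end Spectral
-- Zero sets of real analytic functions.
section NullSet

/-- A real analytic function that is not identically zero is nonzero almost everywhere. -/
lemma ae_ne_zero_of_analyticOnNhd {E : Type*} [NormedAddCommGroup E] [NormedSpace ℝ E]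
    [FiniteDimensional ℝ E] [MeasurableSpace E] [BorelSpace E] (μ : Measure E)
    [μ.IsAddHaarMeasure] {f : E → ℝ} (hf : AnalyticOnNhd ℝ f Set.univ) {x₀ : E} (h0 : f x₀ ≠ 0) :
    ∀ᵐ x ∂μ, f x ≠ 0 := by
  have hcont : Continuous f := continuousOn_univ.1 hf.continuousOn
  have hmeas : Measurable fun p : E × ℝ => f (x₀ + p.2 • p.1) :=
    (hcont.comp (by fun_prop)).measurable
  -- On each line through `x₀` the function is analytic in `t` and nonzero at `t = 0`, so its zeros
  -- are discrete.
  have hline : ∀ x : E, ∀ᵐ t : ℝ, f (x₀ + t • x) ≠ 0 := by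
    intro x
    have ha : AnalyticOnNhd ℝ (fun t : ℝ => f (x₀ + t • x)) Set.univ := by
      intro t _
      exact (hf (x₀ + t • x) (Set.mem_univ _)).fun_comp (f := fun t : ℝ => x₀ + t • x) (by fun_prop)
    have := ha.preimage_zero_mem_codiscrete (x := 0) (by simpa using h0)
    have hae := ae_restrict_le_codiscreteWithin (μ := (volume : Measure ℝ)) MeasurableSet.univ this
    rw [Measure.restrict_univ] at hae
    filter_upwards [hae] with t ht using by simpa using ht
  have hms : MeasurableSet {p : E × ℝ | f (x₀ + p.2 • p.1) ≠ 0} :=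
    hmeas (measurableSet_singleton 0).compl
  have hswap : ∀ᵐ t : ℝ, ∀ᵐ x ∂μ, f (x₀ + t • x) ≠ 0 :=
    (Measure.ae_ae_comm hms).1 (ae_of_all _ hline)
  -- After Fubini one nonzero `t` suffices: `x ↦ x₀ + t • x` scales `μ` by a nonzero constant, so
  -- null preimages come from null sets.
  obtain ⟨t, ht, ht0⟩ := (hswap.and (Measure.ae_ne volume (0 : ℝ))).exists
  have h1 : μ ((fun x => t • x) ⁻¹' {x | f (x₀ + x) = 0}) = 0 := by
    simpa [ae_iff] using ht
  rw [Measure.addHaar_preimage_smul μ ht0, mul_eq_zero] at h1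
  have h2 : μ {x | f (x₀ + x) = 0} = 0 := by
    refine h1.resolve_left ?_
    have : 0 < |(t ^ Module.finrank ℝ E)⁻¹| := by positivity
    exact (ENNReal.ofReal_pos.2 this).ne'
  have h3 : μ ((fun x => x₀ + x) ⁻¹' {x | f x = 0}) = 0 := h2
  rw [measure_preimage_add] at h3
  simpa [ae_iff] using h3

lemma analyticAt_det {E : Type*} [NormedAddCommGroup E] [NormedSpace ℝ E] {ι : Type*}
    [Fintype ι] [DecidableEq ι] {A : E → Matrix ι ι ℝ} {x : E}
    (hA : ∀ i j, AnalyticAt ℝ (fun y => A y i j) x) : AnalyticAt ℝ (fun y => (A y).det) x := by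
  simp only [Matrix.det_apply]
  refine Finset.analyticAt_fun_sum _ fun σ _ => ?_
  have h : AnalyticAt ℝ (fun y => ∏ i, A y (σ i) i) x :=
    Finset.analyticAt_fun_prod _ fun i _ => hA _ _
  have : (fun y => Equiv.Perm.sign σ • ∏ i, A y (σ i) i)
      = fun y => ((Equiv.Perm.sign σ : ℤ) : ℝ) * ∏ i, A y (σ i) i := by
    ext y; simp [Units.smul_def]
  rw [this]
  exact analyticAt_const.mul h

lemma analyticAt_matrix_pow {E : Type*} [NormedAddCommGroup E] [NormedSpace ℝ E] {ι : Type*}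
    [Fintype ι] [DecidableEq ι] {𝔽 : Type*} [NormedRing 𝔽] [NormedAlgebra ℝ 𝔽]
    {A : E → Matrix ι ι 𝔽} {x : E} (hA : ∀ i j, AnalyticAt ℝ (fun y => A y i j) x) (k : ℕ) :
    ∀ i j, AnalyticAt ℝ (fun y => (A y ^ k) i j) x := by
  induction k with
  | zero => intro i j; simpa using analyticAt_const
  | succ k ih =>
    intro i j
    simp only [pow_succ, Matrix.mul_apply]
    exact Finset.analyticAt_fun_sum _ fun m _ => (ih i m).mul (hA m j)

end NullSet

/-! ### Linear coordinates on self-adjoint matrices; almost all of them have distinct eigenvalues.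
-/

section Coordinates

variable {𝔽 : Type} [NormedDivisionRing 𝔽] [StarRing 𝔽] [NormedAlgebra ℝ 𝔽] [StarModule ℝ 𝔽]
  [Inner ℝ 𝔽] [IsHurwitz 𝔽] {n : ℕ}

omit [Inner ℝ 𝔽] [IsHurwitz 𝔽] in
lemma hermOfCoord_apply (c : HermCoord 𝔽 n) (i j : Fin n) :
    (hermOfCoord c : Mat 𝔽 n) i j = if h : i < j then c.2 ⟨(i, j), h⟩
      else if h : j < i then star (c.2 ⟨(j, i), h⟩) else algebraMap ℝ 𝔽 (c.1 i) := rfl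

variable (𝔽 n) in
/-- The coordinates on the self-adjoint matrices as a linear isomorphism. -/
noncomputable def hermCoordEquiv : HermCoord 𝔽 n ≃ₗ[ℝ] Herm 𝔽 n where
  toFun := hermOfCoord
  map_add' c d := by
    apply Subtype.ext
    ext i j
    simp only [AddSubgroup.coe_add, Matrix.add_apply, hermOfCoord_apply]
    split_ifs <;> simp
  map_smul' r c := by
    apply Subtype.ext
    ext i j
    simp only [RingHom.id_apply, selfAdjoint.val_smul, Matrix.smul_apply, hermOfCoord_apply]
    split_ifs
    · simp
    · simp
    · simp [Algebra.smul_def]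
  invFun X := (fun i => rePart 𝔽 ((X : Mat 𝔽 n) i i), fun p => (X : Mat 𝔽 n) p.1.1 p.1.2)
  left_inv c := by
    ext i
    · simp [hermOfCoord_apply, rePart_algebraMap]
    · simp [hermOfCoord_apply, i.2]
  right_inv X := by
    have hX : ∀ i j, star ((X : Mat 𝔽 n) i j) = (X : Mat 𝔽 n) j i := fun i j =>
      congrFun (congrFun (show star (X : Mat 𝔽 n) = X from X.2) j) i
    apply Subtype.ext
    ext i j
    rw [hermOfCoord_apply]
    rcases lt_trichotomy i j with h | h | h
    · simp [h]
    · subst h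
      have h1 := IsHurwitz.add_star ((X : Mat 𝔽 n) i i)
      have h2 : algebraMap ℝ 𝔽 2 ≠ 0 := by simp
      have h3 : algebraMap ℝ 𝔽 2 * (X : Mat 𝔽 n) i i = (X : Mat 𝔽 n) i i + (X : Mat 𝔽 n) i i := by
        rw [map_ofNat, two_mul]
      rw [hX, ← rePart_apply, map_mul, ← h3] at h1
      simpa using (mul_left_cancel₀ h2 h1).symm
    · simp [h, h.not_gt, hX]

variable [FiniteDimensional ℝ 𝔽]

variable (𝔽) in
lemma continuous_rePart : Continuous (rePart 𝔽) := (rePart 𝔽).continuous_of_finiteDimensional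

lemma analyticAt_hermOfCoord (c : HermCoord 𝔽 n) (i j : Fin n) :
    AnalyticAt ℝ (fun c : HermCoord 𝔽 n => (hermOfCoord c : Mat 𝔽 n) i j) c := by
  let L : HermCoord 𝔽 n →ₗ[ℝ] 𝔽 :=
    { toFun := fun c => (hermCoordEquiv 𝔽 n c : Mat 𝔽 n) i j
      map_add' := fun c d => by simp
      map_smul' := fun r c => by simp }
  exact L.toContinuousLinearMap.analyticAt c

/-- Almost all self-adjoint matrices have `n` different eigenvalues. -/
lemma ae_det_powerSumMatrix_ne_zero [MeasurableSpace 𝔽]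
    [BorelSpace 𝔽] (μ : Measure (HermCoord 𝔽 n)) [μ.IsAddHaarMeasure] :
    ∀ᵐ c ∂μ, (powerSumMatrix (hermOfCoord c : Mat 𝔽 n)).det ≠ 0 := by
  have : ProperSpace 𝔽 := FiniteDimensional.proper ℝ 𝔽
  -- The coordinates of `diag(0, 1, …, n - 1)`, where the Hankel determinant is a squared
  -- Vandermonde determinant.
  let D : HermCoord 𝔽 n := (fun i => (i : ℝ), 0)
  refine ae_ne_zero_of_analyticOnNhd μ (x₀ := D) ?_ ?_
  · intro c _
    refine analyticAt_det fun i j => ?_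
    show AnalyticAt ℝ (fun c => (rePart 𝔽).toContinuousLinearMap
      (∑ k, ((hermOfCoord c : Mat 𝔽 n) ^ (i + j : ℕ)) k k)) c
    refine ((rePart 𝔽).toContinuousLinearMap.analyticAt _).fun_comp ?_
    exact Finset.analyticAt_fun_sum _ fun k _ =>
      analyticAt_matrix_pow (analyticAt_hermOfCoord c) _ k k
  · have : (hermOfCoord D : Mat 𝔽 n) = realDiag 𝔽 fun i => (i : ℝ) := by
      ext i j
      rw [hermOfCoord_apply, realDiag, Matrix.diagonal_apply]
      rcases lt_trichotomy i j with h | h | h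
      · simp [h, h.ne, D]
      · subst h; simp [D]
      · simp [h, h.not_gt, h.ne', D]
    rw [this]
    exact det_powerSumMatrix_realDiag_ne_zero fun i j h => Fin.ext (by simpa using h)

end Coordinates
end GaussianFlag

instance Matrix.instBorelSpacePi {m n α : Type*} [Countable m] [Countable n] [TopologicalSpace α]
    [SecondCountableTopology α] [MeasurableSpace α] [BorelSpace α] : BorelSpace (Matrix m n α) :=
  inferInstanceAs (BorelSpace (m → n → α))

instance Matrix.instSecondCountableTopologyPi {m n α : Type*} [Countable m] [Countable n]
    [TopologicalSpace α] [SecondCountableTopology α] : SecondCountableTopology (Matrix m n α) :=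
  inferInstanceAs (SecondCountableTopology (m → n → α))

namespace GaussianFlag

/-! ### The conjugation action, equivariance, and invariance of the density. -/

section Conjugation

variable {𝔽 : Type} [NormedDivisionRing 𝔽] [StarRing 𝔽] {n : ℕ}

/-- Conjugation `X ↦ A X Aᴴ` on the self-adjoint matrices. -/
def conjHerm (A : UnitaryGroup 𝔽 n) (X : Herm 𝔽 n) : Herm 𝔽 n :=
  ⟨(A : Mat 𝔽 n) * X * star (A : Mat 𝔽 n), IsSelfAdjoint.conjugate X.2 (A : Mat 𝔽 n)⟩

lemma coe_conjHerm (A : UnitaryGroup 𝔽 n) (X : Herm 𝔽 n) :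
    (conjHerm A X : Mat 𝔽 n) = (A : Mat 𝔽 n) * X * star (A : Mat 𝔽 n) := rfl

lemma conjHerm_mul (A B : UnitaryGroup 𝔽 n) (X : Herm 𝔽 n) :
    conjHerm (A * B) X = conjHerm A (conjHerm B X) :=
  Subtype.ext (by simp only [coe_conjHerm, Submonoid.coe_mul, star_mul, mul_assoc])

lemma conjHerm_one (X : Herm 𝔽 n) : conjHerm 1 X = X :=
  Subtype.ext (by simp [coe_conjHerm])

lemma continuous_conjHerm (A : UnitaryGroup 𝔽 n) : Continuous (conjHerm A) :=
  Continuous.subtype_mk (by fun_prop) _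

variable [NormedAlgebra ℝ 𝔽]

lemma IsEigenvalueDecomposition.conjHerm {X : Herm 𝔽 n} {Q : UnitaryGroup 𝔽 n} {l : Fin n → ℝ}
    (h : IsEigenvalueDecomposition X Q l) (A : UnitaryGroup 𝔽 n) :
    IsEigenvalueDecomposition (conjHerm A X) (A * Q) l :=
  ⟨h.strictAnti, by rw [coe_conjHerm, h.eq]; simp only [Submonoid.coe_mul, star_mul, mul_assoc]⟩

lemma smul_mk (a : Fin n → ℝ) (A Q : UnitaryGroup 𝔽 n) :
    A • Flag.mk a Q = Flag.mk a (A * Q) :=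
  Subtype.ext (by
    show (A : Mat 𝔽 n) * ((Q : Mat 𝔽 n) * realDiag 𝔽 a * star (Q : Mat 𝔽 n)) * star (A : Mat 𝔽 n)
      = ((A * Q : UnitaryGroup 𝔽 n) : Mat 𝔽 n) * realDiag 𝔽 a
        * star ((A * Q : UnitaryGroup 𝔽 n) : Mat 𝔽 n)
    simp only [Submonoid.coe_mul, star_mul, mul_assoc])

lemma eigenbasisMap_conjHerm (a : Fin n → ℝ) (A : UnitaryGroup 𝔽 n) {X : Herm 𝔽 n}
    (h : ∃ Q l, IsEigenvalueDecomposition X Q l) :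
    eigenbasisMap a (conjHerm A X) = A • eigenbasisMap a X := by
  obtain ⟨Q, l, hQ⟩ := h
  rw [hQ.eigenbasisMap_eq, (hQ.conjHerm A).eigenbasisMap_eq, smul_mk]

variable [StarModule ℝ 𝔽]

/-- Conjugation by a unitary matrix as a linear automorphism of the self-adjoint matrices. -/
def conjHermEquiv (A : UnitaryGroup 𝔽 n) : Herm 𝔽 n ≃ₗ[ℝ] Herm 𝔽 n where
  toFun := conjHerm A
  map_add' X Y := Subtype.ext (by simp [coe_conjHerm, mul_add, add_mul])
  map_smul' r X := Subtype.ext (by simp [coe_conjHerm])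
  invFun := conjHerm A⁻¹
  left_inv X := by rw [← conjHerm_mul, inv_mul_cancel, conjHerm_one]
  right_inv X := by rw [← conjHerm_mul, mul_inv_cancel, conjHerm_one]

variable [Inner ℝ 𝔽] [IsHurwitz 𝔽]

lemma gaussianDensity_eq (X : Herm 𝔽 n) : gaussianDensity 𝔽 n X =
    (2 : ℝ) ^ (-(n : ℝ) / 2) * Real.pi ^ (-((Module.finrank ℝ 𝔽 : ℝ) * n *
      (n - 1 + 2 / (Module.finrank ℝ 𝔽 : ℝ))) / 4) *
    Real.exp (-(reTrace 𝔽 n ((X : Mat 𝔽 n) * X)) / 2) := rfl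

lemma gaussianDensity_conjHerm (A : UnitaryGroup 𝔽 n) (X : Herm 𝔽 n) :
    gaussianDensity 𝔽 n (conjHerm A X) = gaussianDensity 𝔽 n X := by
  have h : reTrace 𝔽 n ((conjHerm A X : Mat 𝔽 n) * conjHerm A X)
      = reTrace 𝔽 n ((X : Mat 𝔽 n) * X) := by
    have h1 : star (A : Mat 𝔽 n) * A = 1 := Unitary.coe_star_mul_self A
    have e : (conjHerm A X : Mat 𝔽 n) * conjHerm A X
        = (A : Mat 𝔽 n) * ((X : Mat 𝔽 n) * X * star (A : Mat 𝔽 n)) := by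
      rw [coe_conjHerm]
      calc _ = (A : Mat 𝔽 n) * X * (star (A : Mat 𝔽 n) * A) * X * star (A : Mat 𝔽 n) := by
            simp only [mul_assoc]
        _ = _ := by rw [h1, mul_one]; simp only [mul_assoc]
    rw [e, reTrace_mul_comm, mul_assoc, h1, mul_one]
  rw [gaussianDensity_eq, gaussianDensity_eq, h]

variable [FiniteDimensional ℝ 𝔽]

lemma continuous_reTrace : Continuous (reTrace 𝔽 n) :=
  (continuous_rePart 𝔽).comp (continuous_id.matrix_trace)

lemma continuous_gaussianDensity : Continuous (gaussianDensity 𝔽 n) := by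
  have : Continuous fun X : Herm 𝔽 n => reTrace 𝔽 n ((X : Mat 𝔽 n) * X) :=
    continuous_reTrace.comp (by fun_prop)
  simp only [funext gaussianDensity_eq]
  fun_prop

lemma continuous_hermOfCoord : Continuous (hermOfCoord : HermCoord 𝔽 n → Herm 𝔽 n) :=
  Continuous.subtype_mk (continuous_matrix fun i j =>
    continuous_iff_continuousAt.2 fun c => (analyticAt_hermOfCoord c i j).continuousAt) _

lemma continuous_hermCoordEquiv_symm : Continuous (hermCoordEquiv 𝔽 n).symm := by
  refine Continuous.prodMk (continuous_pi fun i => (continuous_rePart 𝔽).comp ?_)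
    (continuous_pi fun p => ?_)
  · exact (continuous_subtype_val (p := (· ∈ selfAdjoint (Mat 𝔽 n)))).matrix_elem i i
  · exact (continuous_subtype_val (p := (· ∈ selfAdjoint (Mat 𝔽 n)))).matrix_elem p.1.1 p.1.2

end Conjugation

/-! ### Invariance of the Gaussian ensemble. -/

section Invariance

variable {𝔽 : Type} [NormedDivisionRing 𝔽] [StarRing 𝔽] [NormedAlgebra ℝ 𝔽] [StarModule ℝ 𝔽]
  [Inner ℝ 𝔽] [IsHurwitz 𝔽] [FiniteDimensional ℝ 𝔽]
  [MeasureSpace 𝔽] [BorelSpace 𝔽] [SecondCountableTopology 𝔽]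
  [(volume : Measure 𝔽).IsAddHaarMeasure] {n : ℕ}

instance : BorelSpace (Herm 𝔽 n) := Subtype.borelSpace _

omit [StarRing 𝔽] [StarModule ℝ 𝔽] [Inner ℝ 𝔽] [IsHurwitz 𝔽] in
lemma isAddHaarMeasure_volume_hermCoord :
    (volume : Measure (HermCoord 𝔽 n)).IsAddHaarMeasure := by
  have : ProperSpace 𝔽 := FiniteDimensional.proper ℝ 𝔽
  exact Measure.prod.instIsAddHaarMeasure _ _

/-- The Lebesgue measure is invariant under unitary conjugation up to a factor, which will turn
out to be `1`. -/
lemma exists_map_conjHerm_hermVolume (A : UnitaryGroup 𝔽 n) :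
    ∃ r : ENNReal, (hermVolume 𝔽 n).map (conjHerm A) = r • hermVolume 𝔽 n := by
  have := isAddHaarMeasure_volume_hermCoord (𝔽 := 𝔽) (n := n)
  -- In coordinates conjugation is a linear automorphism, which multiplies Haar measure by
  -- `|det|⁻¹`.
  let e := (hermCoordEquiv 𝔽 n).trans ((conjHermEquiv A).trans (hermCoordEquiv 𝔽 n).symm)
  have hcont : Continuous e := continuous_hermCoordEquiv_symm.comp
    ((continuous_conjHerm A).comp continuous_hermOfCoord)
  have hcomp : conjHerm A ∘ hermOfCoord = hermOfCoord ∘ e := by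
    ext1 c
    exact ((hermCoordEquiv 𝔽 n).apply_symm_apply _).symm
  have hdet : LinearMap.det (e : HermCoord 𝔽 n →ₗ[ℝ] HermCoord 𝔽 n) ≠ 0 :=
    (LinearEquiv.isUnit_det' e).ne_zero
  have hmap := Measure.map_linearMap_addHaar_eq_smul_addHaar
    (volume : Measure (HermCoord 𝔽 n)) hdet
  refine ⟨ENNReal.ofReal |(LinearMap.det (e : HermCoord 𝔽 n →ₗ[ℝ] HermCoord 𝔽 n))⁻¹|, ?_⟩
  rw [hermVolume, Measure.map_map (continuous_conjHerm A).measurable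
    continuous_hermOfCoord.measurable, hcomp, ← Measure.map_map
    continuous_hermOfCoord.measurable hcont.measurable]
  exact (congrArg (Measure.map hermOfCoord) hmap).trans (Measure.map_smul _ _ _)

/-- The Gaussian ensemble is invariant under unitary conjugation. -/
lemma map_conjHerm_gaussianEnsemble [IsProbabilityMeasure (gaussianEnsemble 𝔽 n)]
    (A : UnitaryGroup 𝔽 n) :
    (gaussianEnsemble 𝔽 n).map (conjHerm A) = gaussianEnsemble 𝔽 n := by
  obtain ⟨r, hr⟩ := exists_map_conjHerm_hermVolume (𝔽 := 𝔽) A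
  have hA := (continuous_conjHerm A).measurable
  have hd : Measurable fun X : Herm 𝔽 n => ENNReal.ofReal (gaussianDensity 𝔽 n X) :=
    continuous_gaussianDensity.measurable.ennreal_ofReal
  have h : (gaussianEnsemble 𝔽 n).map (conjHerm A) = r • gaussianEnsemble 𝔽 n := by
    ext s hs
    rw [Measure.map_apply hA hs, Measure.smul_apply, gaussianEnsemble,
      withDensity_apply _ (hA hs), withDensity_apply _ hs]
    calc ∫⁻ X in conjHerm A ⁻¹' s, ENNReal.ofReal (gaussianDensity 𝔽 n X) ∂hermVolume 𝔽 n
        = ∫⁻ X in conjHerm A ⁻¹' s, ENNReal.ofReal (gaussianDensity 𝔽 n (conjHerm A X))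
            ∂hermVolume 𝔽 n := by simp only [gaussianDensity_conjHerm]
      _ = ∫⁻ X in s, ENNReal.ofReal (gaussianDensity 𝔽 n X)
            ∂(hermVolume 𝔽 n).map (conjHerm A) := (setLIntegral_map hs hd hA).symm
      _ = _ := by rw [hr, Measure.restrict_smul, lintegral_smul_measure]
  -- Both sides have total mass `1`, so the determinant of conjugation need not be computed.
  have hr1 : r = 1 := by
    have h2 := congrArg (fun μ : Measure (Herm 𝔽 n) => μ Set.univ) h
    rw [Measure.map_apply hA MeasurableSet.univ, Set.preimage_univ, Measure.smul_apply,
      measure_univ, smul_eq_mul, mul_one] at h2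
    exact h2.symm
  rw [h, hr1, one_smul]

omit [(volume : Measure 𝔽).IsAddHaarMeasure] in
lemma measurableSet_det_powerSumMatrix_ne_zero :
    MeasurableSet {X : Herm 𝔽 n | (powerSumMatrix (X : Mat 𝔽 n)).det ≠ 0} := by
  have hcont : Continuous fun X : Herm 𝔽 n => (powerSumMatrix (X : Mat 𝔽 n)).det := by
    refine Continuous.matrix_det (continuous_matrix fun i j => continuous_reTrace.comp ?_)
    fun_prop
  exact hcont.measurable (measurableSet_singleton 0).compl

lemma ae_gaussianEnsemble_det_ne_zero :
    ∀ᵐ X : Herm 𝔽 n ∂gaussianEnsemble 𝔽 n, (powerSumMatrix (X : Mat 𝔽 n)).det ≠ 0 := by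
  have := isAddHaarMeasure_volume_hermCoord (𝔽 := 𝔽) (n := n)
  have h0 : ∀ᵐ X : Herm 𝔽 n ∂hermVolume 𝔽 n, (powerSumMatrix (X : Mat 𝔽 n)).det ≠ 0 := by
    rw [hermVolume, ae_map_iff continuous_hermOfCoord.aemeasurable
      measurableSet_det_powerSumMatrix_ne_zero]
    exact ae_det_powerSumMatrix_ne_zero _
  exact (withDensity_absolutelyContinuous (hermVolume 𝔽 n) _).ae_le h0

end Invariance
-- Compactness of the unitary group and continuity of the eigenbasis map.
section Compactness

variable {𝔽 : Type} [NormedDivisionRing 𝔽] [StarRing 𝔽] [NormedAlgebra ℝ 𝔽] [StarModule ℝ 𝔽]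
  [Inner ℝ 𝔽] [IsHurwitz 𝔽] [FiniteDimensional ℝ 𝔽] [ContinuousStar 𝔽] {n : ℕ}

omit [StarModule ℝ 𝔽] [FiniteDimensional ℝ 𝔽] [ContinuousStar 𝔽] in
lemma norm_apply_le_one_of_mem_unitary {Q : Mat 𝔽 n} (hQ : Q ∈ unitary (Mat 𝔽 n)) (i j : Fin n) :
    ‖Q i j‖ ≤ 1 := by
  have h := congrFun (congrFun (Unitary.mem_iff.1 hQ).1 j) j
  have h2 : (star Q * Q) j j = star (fun k => Q k j) ⬝ᵥ fun k => Q k j := by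
    simp [Matrix.mul_apply, dotProduct, Matrix.star_apply]
  rw [h2, star_dotProduct_self, Matrix.one_apply_eq, ← map_one (algebraMap ℝ 𝔽)] at h
  have h3 : ∑ k, ‖Q k j‖ ^ 2 = 1 := (algebraMap ℝ 𝔽).injective h
  have h4 : ‖Q i j‖ ^ 2 ≤ 1 := h3 ▸
    Finset.single_le_sum (f := fun k => ‖Q k j‖ ^ 2) (fun k _ => sq_nonneg _) (Finset.mem_univ i)
  exact (sq_le_one_iff₀ (norm_nonneg _)).1 h4

instance : CompactSpace (UnitaryGroup 𝔽 n) := by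
  have : ProperSpace 𝔽 := FiniteDimensional.proper ℝ 𝔽
  refine isCompact_iff_compactSpace.1 (IsCompact.of_isClosed_subset
    (isCompact_univ_pi fun i => isCompact_univ_pi fun j => isCompact_closedBall (0 : 𝔽) 1)
    isClosed_unitary ?_)
  intro Q hQ i _ j _
  simpa using norm_apply_le_one_of_mem_unitary hQ i j

omit [StarRing 𝔽] [StarModule ℝ 𝔽] [Inner ℝ 𝔽] [IsHurwitz 𝔽] [FiniteDimensional ℝ 𝔽]
  [ContinuousStar 𝔽] in
lemma realDiag_apply (d : Fin n → ℝ) (i j : Fin n) :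
    realDiag 𝔽 d i j = if i = j then algebraMap ℝ 𝔽 (d i) else 0 := by
  rw [realDiag, Matrix.diagonal_apply]

omit [ContinuousStar 𝔽] in
/-- Limits of matrices with decreasing diagonal form. -/
lemma exists_antitone_of_tendsto {α : Type*} {f : Filter α} [f.NeBot] {l : α → Fin n → ℝ}
    (hl : ∀ᶠ x in f, StrictAnti (l x)) {D : Mat 𝔽 n}
    (h : Filter.Tendsto (fun x => realDiag 𝔽 (l x)) f (nhds D)) :
    ∃ m : Fin n → ℝ, Antitone m ∧ D = realDiag 𝔽 m := by
  have hij : ∀ i j, Filter.Tendsto (fun x => realDiag 𝔽 (l x) i j) f (nhds (D i j)) :=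
    fun i j => ((continuous_id.matrix_elem i j).tendsto D).comp h
  have hm : ∀ i, Filter.Tendsto (fun x => l x i) f (nhds (rePart 𝔽 (D i i))) := by
    intro i
    have := ((continuous_rePart 𝔽).tendsto (D i i)).comp (hij i i)
    refine this.congr fun x => ?_
    simp [realDiag_apply, rePart_algebraMap]
  refine ⟨fun i => rePart 𝔽 (D i i), fun i j hle => ?_, ?_⟩
  · exact le_of_tendsto_of_tendsto (hm j) (hm i) (hl.mono fun x hx => hx.antitone hle)
  · ext i j
    rw [realDiag_apply]
    by_cases hne : i = j
    · subst hne
      rw [if_pos rfl]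
      refine tendsto_nhds_unique (hij i i) ?_
      have := ((continuous_algebraMap ℝ 𝔽).tendsto _).comp (hm i)
      refine this.congr fun x => ?_
      simp [realDiag_apply]
    · rw [if_neg hne]
      refine tendsto_nhds_unique (hij i j) ?_
      simp [realDiag_apply, hne]

/-- The eigenbasis map is continuous where the eigenvalues are distinct. -/
lemma continuousOn_eigenbasisMap (a : Fin n → ℝ) :
    ContinuousOn (fun X : Herm 𝔽 n => (eigenbasisMap a X).1)
      {X | ∃ Q l, IsEigenvalueDecomposition X Q l} := by
  classical
  set G : Set (Herm 𝔽 n) := {X | ∃ Q l, IsEigenvalueDecomposition X Q l} with hG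
  have hex : ∀ X : Herm 𝔽 n, ∃ p : UnitaryGroup 𝔽 n × (Fin n → ℝ),
      X ∈ G → IsEigenvalueDecomposition X p.1 p.2 := by
    intro X
    by_cases hX : X ∈ G
    · obtain ⟨Q, l, h⟩ := hX
      exact ⟨(Q, l), fun _ => h⟩
    · exact ⟨(1, 0), fun h => absurd h hX⟩
  choose p hp using hex
  intro X hX
  obtain ⟨Q₀, l₀, h₀⟩ := id hX
  rw [ContinuousWithinAt, Filter.tendsto_iff_ultrafilter]
  intro g hg
  have hgG : ∀ᶠ Y in (g : Filter (Herm 𝔽 n)), Y ∈ G := hg self_mem_nhdsWithin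
  have hgX : Filter.Tendsto (fun Y : Herm 𝔽 n => (Y : Mat 𝔽 n)) g (nhds (X : Mat 𝔽 n)) :=
    (continuous_subtype_val.tendsto X).comp (hg.trans nhdsWithin_le_nhds)
  -- The chosen eigenbases need not vary continuously, but by compactness they converge along the
  -- ultrafilter; their limit `Q` will diagonalize `X`.
  obtain ⟨Q, hQ⟩ : ∃ Q : UnitaryGroup 𝔽 n,
      Filter.Tendsto (fun Y => (p Y).1) g (nhds Q) :=
    ⟨_, (g.map fun Y => (p Y).1).le_nhds_lim⟩
  have hQ' : Filter.Tendsto (fun Y => ((p Y).1 : Mat 𝔽 n)) g (nhds (Q : Mat 𝔽 n)) :=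
    (continuous_subtype_val.tendsto Q).comp hQ
  have hQs : Filter.Tendsto (fun Y => star ((p Y).1 : Mat 𝔽 n)) g (nhds (star (Q : Mat 𝔽 n))) :=
    (continuous_star.tendsto _).comp hQ'
  have hD : Filter.Tendsto (fun Y => realDiag 𝔽 (p Y).2) g
      (nhds (star (Q : Mat 𝔽 n) * X * Q)) := by
    refine ((hQs.mul hgX).mul hQ').congr' (hgG.mono fun Y hY => ?_)
    have h1 : star ((p Y).1 : Mat 𝔽 n) * (p Y).1 = 1 := Unitary.coe_star_mul_self _
    have h2 : star ((p Y).1 : Mat 𝔽 n) * ((p Y).1 * realDiag 𝔽 (p Y).2 * star ((p Y).1 : Mat 𝔽 n))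
        * (p Y).1 = realDiag 𝔽 (p Y).2 := by
      rw [mul_assoc, mul_assoc, h1, mul_one, ← mul_assoc, h1, one_mul]
    rw [← (hp Y hY).eq] at h2
    exact h2
  obtain ⟨m, hm, hDm⟩ := exists_antitone_of_tendsto
    (hgG.mono fun Y hY => (hp Y hY).strictAnti) hD
  have hXm : (X : Mat 𝔽 n) = (Q : Mat 𝔽 n) * realDiag 𝔽 m * star (Q : Mat 𝔽 n) := by
    have h2 : (Q : Mat 𝔽 n) * star (Q : Mat 𝔽 n) = 1 := Unitary.coe_mul_star_self Q
    rw [← hDm, ← mul_assoc, ← mul_assoc, h2, one_mul, mul_assoc, h2, mul_one]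
  -- A limit of strictly decreasing sequences may have ties; the `n` distinct eigenvalues of `X`
  -- exclude them.
  have hinj : Function.Injective m := by
    have h1 : HasDistinctEigenvalues X := h₀.hasDistinctEigenvalues
    rw [HasDistinctEigenvalues, hXm, realEigenvalues_conj_realDiag, ← Set.image_univ] at h1
    rw [← Set.injOn_univ]
    refine Set.injOn_of_ncard_image_eq (by rw [h1, Set.ncard_univ, Nat.card_fin])
  have hdec : IsEigenvalueDecomposition X Q m := ⟨hm.strictAnti_of_injective hinj, hXm⟩
  rw [hdec.eigenbasisMap_eq]
  refine ((hQ'.mul_const (realDiag 𝔽 a)).mul hQs).congr' (hgG.mono fun Y hY => ?_)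
  exact congrArg Subtype.val ((hp Y hY).eigenbasisMap_eq a).symm

end Compactness

/-! ### Uniqueness of invariant probability measures on transitive spaces. -/

section Uniqueness

/-- An invariant probability measure on a transitive `G`-space is the image of Haar measure. -/
lemma eq_map_smul_of_invariant {G M : Type*} [Group G] [MeasurableSpace G] [MeasurableSpace M]
    [MulAction G M] [MeasurableSMul₂ G M] [MeasurableMul G] [MulAction.IsPretransitive G M]
    (μ : Measure G) [IsProbabilityMeasure μ] [μ.IsMulRightInvariant] {ν : Measure M}
    [IsProbabilityMeasure ν] (hν : ∀ g : G, ν.map (fun x => g • x) = ν) (x₀ : M) :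
    ν = μ.map (fun g => g • x₀) := by
  have hsmul : Measurable fun p : G × M => p.1 • p.2 := measurable_smul
  ext s hs
  have hx : ∀ x : M, Measurable fun g : G => g • x := fun x => hsmul.comp measurable_prodMk_right
  have hg : ∀ g : G, Measurable fun x : M => g • x := fun g => hsmul.comp measurable_prodMk_left
  have horbit : ∀ x : M, μ ((fun g : G => g • x) ⁻¹' s) = μ ((fun g : G => g • x₀) ⁻¹' s) := by
    intro x
    obtain ⟨h, rfl⟩ := MulAction.exists_smul_eq G x₀ x
    have e : (fun g : G => g • h • x₀) ⁻¹' s =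
        (fun g => g * h) ⁻¹' ((fun g : G => g • x₀) ⁻¹' s) := by
      ext g; simp [mul_smul]
    rw [e, measure_preimage_mul_right]
  have hinv : ∀ g : G, ν ((fun x : M => g • x) ⁻¹' s) = ν s := fun g => by
    rw [← Measure.map_apply (hg g) hs, hν]
  -- The set of pairs with `g • x ∈ s` is measured twice: slicing over `g` uses invariance of `ν`,
  -- slicing over `x` uses transitivity and right invariance of `μ`.
  have h1 : (μ.prod ν) ((fun p : G × M => p.1 • p.2) ⁻¹' s) = ν s := by
    rw [Measure.prod_apply (hsmul hs)]
    calc _ = ∫⁻ _ : G, ν s ∂μ := lintegral_congr fun g => hinv g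
      _ = ν s := by simp
  have h2 : (μ.prod ν) ((fun p : G × M => p.1 • p.2) ⁻¹' s)
      = μ ((fun g : G => g • x₀) ⁻¹' s) := by
    rw [Measure.prod_apply_symm (hsmul hs)]
    calc _ = ∫⁻ _ : M, μ ((fun g : G => g • x₀) ⁻¹' s) ∂ν := lintegral_congr fun x => horbit x
      _ = _ := by simp
  rw [Measure.map_apply (hx x₀) hs, ← h2, h1]

/-- A compact group has a right invariant probability measure. -/
lemma exists_isMulRightInvariant (G : Type*) [Group G] [TopologicalSpace G] [IsTopologicalGroup G]
    [CompactSpace G] [MeasurableSpace G] [BorelSpace G] :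
    ∃ μ : Measure G, IsProbabilityMeasure μ ∧ μ.IsMulRightInvariant := by
  let μ : Measure G := Measure.haarMeasure ⊤
  have : IsProbabilityMeasure μ := ⟨by
    simpa using Measure.haarMeasure_self (K₀ := (⊤ : TopologicalSpace.PositiveCompacts G))⟩
  -- Inversion turns left invariance into right invariance.
  refine ⟨μ.inv, ⟨?_⟩, inferInstance⟩
  rw [Measure.inv_apply]
  simp

variable {𝔽 : Type} [NormedDivisionRing 𝔽] [StarRing 𝔽] [NormedAlgebra ℝ 𝔽] {n : ℕ}

instance (a : Fin n → ℝ) : MulAction.IsPretransitive (UnitaryGroup 𝔽 n) (Flag 𝔽 a) := by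
  have hmk : ∀ Y : Flag 𝔽 a, ∃ Q, Y = Flag.mk a Q := fun Y => by
    obtain ⟨Q, hQ⟩ := Y.2
    exact ⟨Q, Subtype.ext hQ⟩
  refine ⟨fun Y Z => ?_⟩
  obtain ⟨Q, rfl⟩ := hmk Y
  obtain ⟨R, rfl⟩ := hmk Z
  exact ⟨R * Q⁻¹, by rw [smul_mk, inv_mul_cancel_right]⟩

variable [MeasurableSpace 𝔽] [BorelSpace 𝔽] [SecondCountableTopology 𝔽] [ContinuousStar 𝔽]

instance (a : Fin n → ℝ) : MeasurableSMul₂ (UnitaryGroup 𝔽 n) (Flag 𝔽 a) := by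
  refine ⟨?_⟩
  have h : Continuous fun p : Mat 𝔽 n × Mat 𝔽 n => p.1 * p.2 * star p.1 := by fun_prop
  have hval : Measurable fun p : UnitaryGroup 𝔽 n × Flag 𝔽 a => ((p.1 : Mat 𝔽 n), p.2.1) :=
    (measurable_subtype_coe.comp measurable_fst).prodMk
      (measurable_subtype_coe.comp measurable_snd)
  exact (h.measurable.comp hval).subtype_mk

instance : BorelSpace (UnitaryGroup 𝔽 n) := Subtype.borelSpace _

end Uniqueness

/-! ### The law of the eigenbasis. -/

section Main

variable {𝔽 : Type} [NormedDivisionRing 𝔽] [StarRing 𝔽] [NormedAlgebra ℝ 𝔽] [StarModule ℝ 𝔽]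
  [Inner ℝ 𝔽] [IsHurwitz 𝔽] [FiniteDimensional ℝ 𝔽] [ContinuousStar 𝔽] {n : ℕ}

omit [StarModule ℝ 𝔽] in
/-- Two invariant probability measures on the flag manifold are equal. -/
lemma flag_invariant_unique [MeasurableSpace 𝔽] [BorelSpace 𝔽] [SecondCountableTopology 𝔽]
    {a : Fin n → ℝ} {ν ν' : Measure (Flag 𝔽 a)}
    [IsProbabilityMeasure ν] [IsProbabilityMeasure ν']
    (hν : ∀ g : UnitaryGroup 𝔽 n, ν.map (fun x => g • x) = ν)
    (hν' : ∀ g : UnitaryGroup 𝔽 n, ν'.map (fun x => g • x) = ν') : ν' = ν := by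
  obtain ⟨μ, hμ, hμ'⟩ := exists_isMulRightInvariant (UnitaryGroup 𝔽 n)
  rw [eq_map_smul_of_invariant μ hν (Flag.mk a 1), eq_map_smul_of_invariant μ hν' (Flag.mk a 1)]

omit [FiniteDimensional ℝ 𝔽] [ContinuousStar 𝔽] in
lemma eigenbasisMap_wellDefined (a : Fin n → ℝ) (X : Herm 𝔽 n) (hX : HasDistinctEigenvalues X) :
    (∃ Q l, IsEigenvalueDecomposition X Q l) ∧
      ∀ Q l, IsEigenvalueDecomposition X Q l → eigenbasisMap a X = Flag.mk a Q :=
  ⟨hX.exists_isEigenvalueDecomposition, fun _ _ h => h.eigenbasisMap_eq a⟩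

variable [MeasureSpace 𝔽] [BorelSpace 𝔽] [SecondCountableTopology 𝔽]
  [(volume : Measure 𝔽).IsAddHaarMeasure]

/-- The map is defined by choice, but it is continuous on the measurable set where the Hankel
determinant is nonzero, and this set has full measure. -/
lemma aemeasurable_eigenbasisMap (a : Fin n → ℝ) :
    AEMeasurable (eigenbasisMap a) (gaussianEnsemble 𝔽 n) := by
  set s := {X : Herm 𝔽 n | (powerSumMatrix (X : Mat 𝔽 n)).det ≠ 0}
  have hres : (gaussianEnsemble 𝔽 n).restrict s = gaussianEnsemble 𝔽 n :=
    Measure.restrict_eq_self_of_ae_mem ae_gaussianEnsemble_det_ne_zero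
  have h1 : AEMeasurable (fun X : Herm 𝔽 n => (eigenbasisMap a X).1)
      ((gaussianEnsemble 𝔽 n).restrict s) :=
    ((continuousOn_eigenbasisMap a).mono fun X hX =>
      exists_isEigenvalueDecomposition_of_det_ne_zero hX).aemeasurable
        measurableSet_det_powerSumMatrix_ne_zero
  rw [hres] at h1
  exact h1.subtype_mk

/-- The eigenbasis of a random matrix from a Gaussian ensemble is uniformly distributed. -/
theorem isUniformDistribution_eigenbasisMap (a : Fin n → ℝ) {Ω : Type*} [MeasurableSpace Ω]
    (P : Measure Ω) [IsProbabilityMeasure P] (X : Ω → Herm 𝔽 n)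
    (hX : HasLaw X (gaussianEnsemble 𝔽 n) P) :
    (∀ᵐ ω ∂P, HasDistinctEigenvalues (X ω)) ∧
      AEMeasurable (fun ω => eigenbasisMap a (X ω)) P ∧
      IsUniformDistribution (UnitaryGroup 𝔽 n) (P.map fun ω => eigenbasisMap a (X ω)) := by
  -- Total mass `1` is inherited from `P` through the law of `X`, so no Gaussian integral is
  -- evaluated.
  have hprob : IsProbabilityMeasure (gaussianEnsemble 𝔽 n) :=
    hX.map_eq ▸ Measure.isProbabilityMeasure_map hX.aemeasurable
  have hdec : ∀ᵐ Y ∂gaussianEnsemble 𝔽 n, ∃ Q l, IsEigenvalueDecomposition Y Q l :=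
    ae_gaussianEnsemble_det_ne_zero.mono fun Y hY =>
      exists_isEigenvalueDecomposition_of_det_ne_zero hY
  have hφ : AEMeasurable (eigenbasisMap a) (P.map X) :=
    hX.map_eq.symm ▸ aemeasurable_eigenbasisMap a
  have hφX : AEMeasurable (fun ω => eigenbasisMap a (X ω)) P := hφ.comp_aemeasurable hX.aemeasurable
  have hlaw : P.map (fun ω => eigenbasisMap a (X ω))
      = (gaussianEnsemble 𝔽 n).map (eigenbasisMap a) := by
    rw [← hX.map_eq, AEMeasurable.map_map_of_aemeasurable hφ hX.aemeasurable]
    rfl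
  refine ⟨?_, hφX, ?_⟩
  · rw [← hX.map_eq] at hdec
    exact (ae_of_ae_map hX.aemeasurable hdec).mono fun ω ⟨Q, l, h⟩ => h.hasDistinctEigenvalues
  · have hp : IsProbabilityMeasure (P.map fun ω => eigenbasisMap a (X ω)) :=
      Measure.isProbabilityMeasure_map hφX
    have hinv : ∀ g : UnitaryGroup 𝔽 n,
        (P.map fun ω => eigenbasisMap a (X ω)).map (fun x => g • x)
          = P.map fun ω => eigenbasisMap a (X ω) := by
      intro g
      have hφ' := aemeasurable_eigenbasisMap (𝔽 := 𝔽) a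
      have hφg : AEMeasurable (eigenbasisMap a) ((gaussianEnsemble 𝔽 n).map (conjHerm g)) := by
        rwa [map_conjHerm_gaussianEnsemble]
      rw [hlaw, AEMeasurable.map_map_of_aemeasurable (measurable_const_smul g).aemeasurable hφ']
      calc _ = (gaussianEnsemble 𝔽 n).map (eigenbasisMap a ∘ conjHerm g) :=
            Measure.map_congr (hdec.mono fun Y hY => (eigenbasisMap_conjHerm a g hY).symm)
        _ = ((gaussianEnsemble 𝔽 n).map (conjHerm g)).map (eigenbasisMap a) :=
            (AEMeasurable.map_map_of_aemeasurable hφg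
              (continuous_conjHerm g).aemeasurable).symm
        _ = _ := by rw [map_conjHerm_gaussianEnsemble]
    exact ⟨hp, hinv, fun ν' hν' h' => flag_invariant_unique hinv h'⟩

end Main
end GaussianFlag

theorem mainTheorem2 (n : ℕ) (a : Fin n → ℝ) (ha : Function.Injective a)
    {Ω : Type*} [MeasurableSpace Ω] (P : Measure Ω) [IsProbabilityMeasure P] :
    -- the real case
    ((∀ X : GaussianFlag.Herm ℝ n, GaussianFlag.HasDistinctEigenvalues X →
        (∃ Q l, GaussianFlag.IsEigenvalueDecomposition X Q l) ∧
        ∀ Q l, GaussianFlag.IsEigenvalueDecomposition X Q l →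
          GaussianFlag.eigenbasisMap a X = GaussianFlag.Flag.mk a Q) ∧
      ∀ X : Ω → GaussianFlag.Herm ℝ n, HasLaw X (GaussianFlag.GOE n) P →
        (∀ᵐ ω ∂P, GaussianFlag.HasDistinctEigenvalues (X ω)) ∧
        AEMeasurable (fun ω => GaussianFlag.eigenbasisMap a (X ω)) P ∧
        GaussianFlag.IsUniformDistribution (GaussianFlag.UnitaryGroup ℝ n)
          (P.map fun ω => GaussianFlag.eigenbasisMap a (X ω))) ∧
    -- the complex case
    ((∀ X : GaussianFlag.Herm ℂ n, GaussianFlag.HasDistinctEigenvalues X →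
        (∃ Q l, GaussianFlag.IsEigenvalueDecomposition X Q l) ∧
        ∀ Q l, GaussianFlag.IsEigenvalueDecomposition X Q l →
          GaussianFlag.eigenbasisMap a X = GaussianFlag.Flag.mk a Q) ∧
      ∀ X : Ω → GaussianFlag.Herm ℂ n, HasLaw X (GaussianFlag.GUE n) P →
        (∀ᵐ ω ∂P, GaussianFlag.HasDistinctEigenvalues (X ω)) ∧
        AEMeasurable (fun ω => GaussianFlag.eigenbasisMap a (X ω)) P ∧
        GaussianFlag.IsUniformDistribution (GaussianFlag.UnitaryGroup ℂ n)
          (P.map fun ω => GaussianFlag.eigenbasisMap a (X ω))) ∧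
    -- the quaternionic case
    ((∀ X : GaussianFlag.Herm (Quaternion ℝ) n, GaussianFlag.HasDistinctEigenvalues X →
        (∃ Q l, GaussianFlag.IsEigenvalueDecomposition X Q l) ∧
        ∀ Q l, GaussianFlag.IsEigenvalueDecomposition X Q l →
          GaussianFlag.eigenbasisMap a X = GaussianFlag.Flag.mk a Q) ∧
      ∀ X : Ω → GaussianFlag.Herm (Quaternion ℝ) n, HasLaw X (GaussianFlag.GSE n) P →
        (∀ᵐ ω ∂P, GaussianFlag.HasDistinctEigenvalues (X ω)) ∧
        AEMeasurable (fun ω => GaussianFlag.eigenbasisMap a (X ω)) P ∧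
        GaussianFlag.IsUniformDistribution (GaussianFlag.UnitaryGroup (Quaternion ℝ) n)
          (P.map fun ω => GaussianFlag.eigenbasisMap a (X ω))) :=
  ⟨⟨GaussianFlag.eigenbasisMap_wellDefined a,
      GaussianFlag.isUniformDistribution_eigenbasisMap a P⟩,
    ⟨GaussianFlag.eigenbasisMap_wellDefined a,
      GaussianFlag.isUniformDistribution_eigenbasisMap a P⟩,
    ⟨GaussianFlag.eigenbasisMap_wellDefined a,
      GaussianFlag.isUniformDistribution_eigenbasisMap a P⟩⟩
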